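/- The following five definitions each determine exactly one integer sequence indexed by $n\ge 1$, and all five determine the same sequence (OEIS A086377: $1,4,6,8,11,13,16,\dots$). Here "$k$ is in the sequence" means that $k$ equals some term of the sequence that is being defined. (a) $a_1=1$ and, for $n\ge 2$: $a_n=a_{n-1}+2$ if $n$ is in the sequence; $a_n=a_{n-1}+2$ if neither $n$ nor $n-1$ is in the sequence; $a_n=a_{n-1}+3$ if $n$ is not in the sequence but $n-1$ is. (b) $b_1=1$ and, for $n\ge 2$: $b_n=b_{n-1}+2$ if $n-1$ is not in the sequence; $b_n=b_{n-1}+3$ if $n-1$ is in the sequence. (c) For $n\ge 1$, $c_n$ is the position (counted from $1$) of the $n$-th zero in the fixed point of the morphism $0\mapsto 011$, $1\mapsto 01$, that is, in the unique infinite word over $\{0,1\}$ that is unchanged when all its letters are simultaneously replaced by their images. (d) $d_n=\left\lfloor (1+\sqrt2)\,n-\tfrac12\sqrt2\right\rfloor$ for $n\ge 1$. (e) $e_n=\left\lfloor r_n+\tfrac12\right\rfloor$ for $n\ge 1$, where $r_1=\dfrac4\pi$ and $r_{n+1}=\dfrac{n^2}{r_n-(2n-1)}$ for $n\ge 1$;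 here the denominators $r_n-(2n-1)$ are all nonzero. -/

import Mathlib

/-- `k` is in the sequence `s_1, s_2, s_3, …`. -/
def InSeq (k : ℕ+) (s : ℕ+ → ℤ) : Prop := ∃ m : ℕ+, s m = (k : ℤ)

/-- Cloitre's recursion, the step from `a_n` to `a_{n+1}` being written for `n ≥ 1`. -/
structure IsCloitreSeq (a : ℕ+ → ℤ) : Prop where
  one : a 1 = 1
  step_mem : ∀ n : ℕ+, InSeq (n + 1) a → a (n + 1) = a n + 2
  step_not_mem_not_mem : ∀ n : ℕ+, ¬ InSeq (n + 1) a → ¬ InSeq n a → a (n + 1) = a n + 2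
  step_not_mem_mem : ∀ n : ℕ+, ¬ InSeq (n + 1) a → InSeq n a → a (n + 1) = a n + 3

/-- The simplified recursion, the step from `b_n` to `b_{n+1}` being written for `n ≥ 1`. -/
structure IsSimpleSeq (b : ℕ+ → ℤ) : Prop where
  one : b 1 = 1
  step_not_mem : ∀ n : ℕ+, ¬ InSeq n b → b (n + 1) = b n + 2
  step_mem : ∀ n : ℕ+, InSeq n b → b (n + 1) = b n + 3

/-- The morphism `0 ↦ 011`, `1 ↦ 01`, given on letters. -/
def phi : Fin 2 → List (Fin 2) := ![[0, 1, 1], [0, 1]]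

/-- The first `n` letters of the infinite word `w 0, w 1, w 2, …`. -/
def wordPrefix (w : ℕ → Fin 2) (n : ℕ) : List (Fin 2) := (List.range n).map w

/-- The infinite word `w` is a fixed point of the morphism `phi`: the image of every finite prefix
of `w` (the concatenation of the images of its letters) is again a prefix of `w`. No letter is
erased by `phi`, so these images become arbitrarily long and this says `phi(w) = w`. -/
def IsFixedWord (w : ℕ → Fin 2) : Prop :=
  ∀ n : ℕ, ∃ m : ℕ, (wordPrefix w n).flatMap phi = wordPrefix w m

/-- For every `n ≥ 1`, `c n` is the position of the `n`-th zero of the infinite word `w`, where the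
letter `w i` is at position `i + 1`. -/
def IsZeroPositions (w : ℕ → Fin 2) (c : ℕ+ → ℤ) : Prop :=
  ∀ n : ℕ+, ∃ i : ℕ, c n = (i : ℤ) + 1 ∧ w i = 0 ∧ Nat.count (fun j => w j = 0) (i + 1) = (n : ℕ)

/-- `c` lists the positions of the zeros of a fixed point of the morphism. -/
def IsMorphicSeq (c : ℕ+ → ℤ) : Prop :=
  ∃ w : ℕ → Fin 2, IsFixedWord w ∧ IsZeroPositions w c

/-- The Beatty sequence `⌊(1 + √2) n - √2 / 2⌋`. -/
def IsBeattySeq (d : ℕ+ → ℤ) : Prop :=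
  ∀ n : ℕ+, d n = ⌊(1 + Real.sqrt 2) * (n : ℝ) - 1 / 2 * Real.sqrt 2⌋

/-- `r_1 = 4 / π` and `r_{n+1} = n ^ 2 / (r_n - (2 n - 1))` for `n ≥ 1`, where no denominator
vanishes. -/
structure IsPiRecurrence (r : ℕ+ → ℝ) : Prop where
  one : r 1 = 4 / Real.pi
  denom_ne_zero : ∀ n : ℕ+, r n - (2 * (n : ℝ) - 1) ≠ 0
  step : ∀ n : ℕ+, r (n + 1) = (n : ℝ) ^ 2 / (r n - (2 * (n : ℝ) - 1))

/-- The terms `r_n` of the recurrence, rounded to the nearest integer. -/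
def IsRoundingSeq (e : ℕ+ → ℤ) : Prop :=
  ∃ r : ℕ+ → ℝ, IsPiRecurrence r ∧ ∀ n : ℕ+, e n = ⌊r n + 1 / 2⌋

/-!
All five descriptions are compared with the simplified recursion, which has at most one
solution because whether `n` is a term depends only on the first `n` terms (`IsSimpleSeq.unique`).

Both integer recursions make steps of size at least two, so `n` and `n + 1` are never both terms; this
makes Cloitre's recursion equivalent to the simplified one (`isCloitreSeq_iff_isSimpleSeq`). For the
Beatty sequence both "`n` is a term" and "the step at `n` has size three" say that the fractional
part of `(n - 1 / 2) √2` exceeds `2 - √2` (`isSimpleSeq_of_isBeattySeq`). In a fixed point of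
the morphism the `n`-th zero is the first letter of the image of the `n`-th letter, and that image
has length three or two according to whether the letter is a zero, that is, whether `n` is the
position of a zero: again the simplified recursion (`IsFixedWord.isSimpleSeq`). Conversely the word
with zeros at the positions given by the solution is fixed (`isFixedWord_wordOfSeq`).

The recurrence starting at `4 / π` is solved by ratios of the positive integrals
`I m = ∫ (√2 cos x - 1) ^ m` over `[0, π / 4]`, which satisfy
`m I (m - 1) = (2 m + 1) I m + (m + 1) I (m + 1)`. Hence all `r n` are defined and positive. Read
backwards, `r n = 2 n - 1 + n ^ 2 / r (n + 1)` is a contraction, so a positive solution lies in every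
family of intervals of linear size that the backward iteration respects
(`mem_Icc_of_backward_iteration`). This gives
`0 ≤ r n - (1 + √2) (n - 1 / 2) ≤ (√2 - 1) / (4 n + 2)`, and since no integer `j` satisfies
`(2 n - 1) ^ 2 < 2 j ^ 2 < (2 n - 1) ^ 2 + 1`, no integer separates `r n + 1 / 2` from
`(1 + √2) n - √2 / 2` (`floor_piTerm`).
-/

/-! ### Sequences with gaps at least two -/

theorem add_two_le_of_lt {b : ℕ+ → ℤ} (hb : ∀ n, b n + 2 ≤ b (n + 1)) {m n : ℕ+} (h : m < n) :
    b m + 2 ≤ b n := by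
  induction n using PNat.recOn with
  | one => exact absurd h (not_lt_one)
  | succ n ih =>
    rcases (PNat.lt_add_one_iff.mp h).lt_or_eq with h' | rfl
    · have := ih h'
      have := hb n
      omega
    · exact hb m

theorem two_mul_sub_one_le {b : ℕ+ → ℤ} (h1 : b 1 = 1) (hb : ∀ n, b n + 2 ≤ b (n + 1)) (n : ℕ+) :
    2 * (n : ℤ) - 1 ≤ b n := by
  induction n using PNat.recOn with
  | one => simp [h1]
  | succ n ih =>
    have := hb n
    push_cast
    omega

theorem not_inSeq_of_between {b : ℕ+ → ℤ} (hb : ∀ n, b n + 2 ≤ b (n + 1)) {k n : ℕ+}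
    (h1 : b n < (k : ℤ)) (h2 : (k : ℤ) < b (n + 1)) : ¬ InSeq k b := by
  rintro ⟨m, hm⟩
  rcases lt_trichotomy m n with h | rfl | h
  · have := add_two_le_of_lt hb h
    omega
  · omega
  · rcases (PNat.add_one_le_iff.mpr h).lt_or_eq with h' | rfl
    · have := add_two_le_of_lt hb h'
      omega
    · omega

theorem not_inSeq_succ {b : ℕ+ → ℤ} (hb : ∀ n, b n + 2 ≤ b (n + 1)) {k : ℕ+} (hk : InSeq k b) :
    ¬ InSeq (k + 1) b := by
  obtain ⟨n, hn⟩ := hk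
  have := hb n
  refine not_inSeq_of_between (n := n) hb ?_ ?_ <;> push_cast <;> omega

theorem IsSimpleSeq.gap {b : ℕ+ → ℤ} (h : IsSimpleSeq b) (n : ℕ+) : b n + 2 ≤ b (n + 1) := by
  by_cases hn : InSeq n b
  · have := h.step_mem n hn
    omega
  · have := h.step_not_mem n hn
    omega

theorem IsCloitreSeq.gap {a : ℕ+ → ℤ} (h : IsCloitreSeq a) (n : ℕ+) : a n + 2 ≤ a (n + 1) := by
  by_cases hn : InSeq (n + 1) a
  · have := h.step_mem n hn
    omega
  · by_cases hn' : InSeq n a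
    · have := h.step_not_mem_mem n hn hn'
      omega
    · have := h.step_not_mem_not_mem n hn hn'
      omega

/-- Since the gaps are at least two, `n` and `n + 1` are never both in the sequence, and this turns
the three cases of Cloitre's recursion into the two cases of the simplified one. -/
theorem isCloitreSeq_iff_isSimpleSeq {a : ℕ+ → ℤ} : IsCloitreSeq a ↔ IsSimpleSeq a := by
  constructor
  · intro h
    refine ⟨h.one, fun n hn => ?_, fun n hn => ?_⟩
    · by_cases hn' : InSeq (n + 1) a
      · exact h.step_mem n hn'
      · exact h.step_not_mem_not_mem n hn' hn
    · exact h.step_not_mem_mem n (not_inSeq_succ h.gap hn) hn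
  · intro h
    refine ⟨h.one, fun n hn => ?_, fun n _ hn => h.step_not_mem n hn,
      fun n _ hn => h.step_mem n hn⟩
    exact h.step_not_mem n fun hn' => not_inSeq_succ h.gap hn' hn

/-- The recursion determines its solution: `b m = n` forces `m ≤ n`, so whether `n` is a term is
decided by the terms up to the `n`-th. -/
theorem IsSimpleSeq.unique {b c : ℕ+ → ℤ} (hb : IsSimpleSeq b) (hc : IsSimpleSeq c) : b = c := by
  have key : ∀ n : ℕ+, ∀ m ≤ n, b m = c m := by
    intro n
    induction n using PNat.recOn with
    | one =>
      intro m hm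
      obtain rfl : m = 1 := le_antisymm hm one_le
      rw [hb.one, hc.one]
    | succ n ih =>
      intro m hm
      rcases hm.lt_or_eq with hm | rfl
      · exact ih m (PNat.lt_add_one_iff.mp hm)
      have hiff : InSeq n b ↔ InSeq n c := by
        refine exists_congr fun m => ?_
        by_cases hmn : m ≤ n
        · rw [ih m hmn]
        · have h1 := two_mul_sub_one_le hb.one hb.gap m
          have h2 := two_mul_sub_one_le hc.one hc.gap m
          have h3 : (n : ℕ) < m := PNat.coe_lt_coe _ _ |>.mpr (not_le.mp hmn)
          have h4 := n.pos
          constructor <;> intro h <;> omega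
      by_cases hn : InSeq n b
      · rw [hb.step_mem n hn, hc.step_mem n (hiff.mp hn), ih n le_rfl]
      · rw [hb.step_not_mem n hn, hc.step_not_mem n (mt hiff.mpr hn), ih n le_rfl]
  exact funext fun n => key n n le_rfl

/-! ### The Beatty sequence solves the recursion -/

theorem odd_mul_sqrt_two_ne (a b : ℤ) : (2 * (a : ℝ) + 1) * Real.sqrt 2 ≠ 2 * b := by
  intro h
  have h2 : ((2 * a + 1) ^ 2 * 2 : ℝ) = (2 * b) ^ 2 := by
    rw [← h, mul_pow, Real.sq_sqrt (by norm_num)]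
  have h3 : (2 * a + 1) ^ 2 * 2 = (2 * b) ^ 2 := by exact_mod_cast h2
  have h4 : 4 * (a * a + a) + 1 = 2 * (b * b) := by linarith [h3]
  omega

/-- Membership of `n` means that an integer `m` satisfies
`(√2 - 1) (n + √2 / 2) ≤ m < (√2 - 1) (n + 1 + √2 / 2)`; a step of size three means that the
fractional part of `(n - 1 / 2) √2` is at least `2 - √2`. These two conditions agree because
`(1 + √2) (√2 - 1) = 1` and the end points of the intervals are irrational. -/
theorem isSimpleSeq_of_isBeattySeq {d : ℕ+ → ℤ} (hd : IsBeattySeq d) : IsSimpleSeq d := by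
  have hs : Real.sqrt 2 ^ 2 = 2 := Real.sq_sqrt (by norm_num)
  have hs1 : 1.4 < Real.sqrt 2 := Real.lt_sqrt_of_sq_lt (by norm_num)
  have hs2 : Real.sqrt 2 < 1.5 := (Real.sqrt_lt' (by norm_num)).mpr (by norm_num)
  have hd' : ∀ n k, d n = k ↔ (k : ℝ) ≤ (1 + Real.sqrt 2) * (n : ℝ) - 1 / 2 * Real.sqrt 2 ∧
      (1 + Real.sqrt 2) * (n : ℝ) - 1 / 2 * Real.sqrt 2 < k + 1 := fun n k => by
    rw [hd n, Int.floor_eq_iff]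
  set σ := Real.sqrt 2 with hσ
  refine ⟨?_, fun n hn => ?_, fun n hn => ?_⟩
  · rw [hd']
    constructor <;> push_cast <;> linarith
  · obtain ⟨h1, h2⟩ := (hd' n _).mp rfl
    rw [hd']
    refine ⟨by push_cast; linarith, ?_⟩
    push_cast
    by_contra! h3
    apply hn
    have hn1 : (1 : ℝ) ≤ n := by exact_mod_cast (one_le : 1 ≤ n)
    -- The index at which the value `n` is attained.
    obtain ⟨m, hm⟩ : ∃ m : ℤ, m = d n + 2 - 2 * n := ⟨_, rfl⟩
    have hmR : (m : ℝ) = d n + 2 - 2 * n := by rw [hm]; push_cast; ring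
    have hlo : (n : ℝ) * σ - 1 / 2 * σ + 1 - n < m := by rw [hmR]; linarith
    have hhi : (m : ℝ) ≤ n * σ + 1 / 2 * σ - n := by rw [hmR]; linarith
    have hhi' : (m : ℝ) < n * σ + 1 / 2 * σ - n := by
      refine lt_of_le_of_ne hhi fun h => odd_mul_sqrt_two_ne n (m + n) ?_
      push_cast
      rw [h, ← hσ]
      ring
    have hm0 : 0 < m := by
      have : (0 : ℝ) < m := by nlinarith
      exact_mod_cast this
    obtain ⟨p, hp⟩ : ∃ p : ℕ+, (p : ℤ) = m := ⟨m.toNat.toPNat (by omega),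
      Int.toNat_of_nonneg hm0.le⟩
    have hpR : (p : ℝ) = m := by rw [← hp]; simp
    refine ⟨p, ?_⟩
    rw [hd', hpR]
    push_cast
    constructor
    · nlinarith [mul_lt_mul_of_pos_left hlo (by linarith : 0 < 1 + σ)]
    · nlinarith [mul_lt_mul_of_pos_left hhi' (by linarith : 0 < 1 + σ)]
  · obtain ⟨m, hm⟩ := hn
    obtain ⟨h1, h2⟩ := (hd' n _).mp rfl
    obtain ⟨h4, h5⟩ := (hd' m _).mp hm
    push_cast at h4 h5
    rw [hd']
    refine ⟨?_, by push_cast; linarith⟩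
    push_cast
    by_contra! h3
    have hlo : (n : ℝ) * σ - 1 / 2 * σ + 1 - n ≤ m := by
      nlinarith [mul_le_mul_of_nonneg_left h4 (by linarith : 0 ≤ σ - 1)]
    have hhi : (m : ℝ) < n * σ + 1 / 2 * σ - n := by
      nlinarith [mul_lt_mul_of_pos_left h5 (by linarith : 0 < σ - 1)]
    have hlt : (m : ℤ) < d n + 2 - 2 * n := by
      have : (m : ℝ) < d n + 2 - 2 * n := by linarith
      exact_mod_cast this
    have hle : (m : ℝ) ≤ d n + 1 - 2 * n := by
      have : (m : ℤ) ≤ d n + 1 - 2 * n := by omega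
      exact_mod_cast this
    refine odd_mul_sqrt_two_ne (n - 1) (m + n - 1) ?_
    push_cast
    rw [← hσ]
    linarith

/-! ### The fixed point of the morphism -/

theorem wordPrefix_add (w : ℕ → Fin 2) (a b : ℕ) :
    wordPrefix w (a + b) = wordPrefix w a ++ (List.range b).map fun j => w (a + j) := by
  simp [wordPrefix, List.range_add, Function.comp_def]

theorem length_wordPrefix (w : ℕ → Fin 2) (n : ℕ) : (wordPrefix w n).length = n := by
  simp [wordPrefix]

/-- The length of the image under `phi` of the first `n` letters of `w`. -/
def imageLength (w : ℕ → Fin 2) (n : ℕ) : ℕ := ((wordPrefix w n).flatMap phi).length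

theorem flatMap_wordPrefix_succ (w : ℕ → Fin 2) (n : ℕ) :
    (wordPrefix w (n + 1)).flatMap phi = (wordPrefix w n).flatMap phi ++ phi (w n) := by
  simp [wordPrefix, List.range_succ]

theorem imageLength_succ (w : ℕ → Fin 2) (n : ℕ) :
    imageLength w (n + 1) = imageLength w n + (phi (w n)).length := by
  simp [imageLength, flatMap_wordPrefix_succ]

theorem IsFixedWord.flatMap_eq {w : ℕ → Fin 2} (hw : IsFixedWord w) (n : ℕ) :
    (wordPrefix w n).flatMap phi = wordPrefix w (imageLength w n) := by
  obtain ⟨m, hm⟩ := hw n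
  rw [imageLength, hm, length_wordPrefix]

theorem IsFixedWord.phi_eq {w : ℕ → Fin 2} (hw : IsFixedWord w) (n : ℕ) :
    phi (w n) = (List.range (phi (w n)).length).map fun j => w (imageLength w n + j) := by
  have h := hw.flatMap_eq (n + 1)
  rw [flatMap_wordPrefix_succ, imageLength_succ, wordPrefix_add, hw.flatMap_eq n] at h
  exact List.append_cancel_left h

theorem IsFixedWord.block {w : ℕ → Fin 2} (hw : IsFixedWord w) (n : ℕ) :
    w (imageLength w n) = 0 ∧
      imageLength w (n + 1) = imageLength w n + (if w n = 0 then 3 else 2) ∧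
      Nat.count (fun j => w (imageLength w n + j) = 0) (if w n = 0 then 3 else 2) = 1 := by
  have h := hw.phi_eq n
  have hl := imageLength_succ w n
  obtain h0 | h1 : w n = 0 ∨ w n = 1 := by omega
  · simp [h0, phi, List.range_succ] at h hl
    simp [h0, hl, Nat.count_succ, ← h.1, ← h.2.1, ← h.2.2]
  · simp [h1, phi, List.range_succ] at h hl
    simp [h1, hl, Nat.count_succ, ← h.1, ← h.2]

/-- Every image of a letter holds exactly one zero, its first letter; so the zeros of a fixed word
are the places where the images of its letters begin. -/
theorem IsFixedWord.count_imageLength {w : ℕ → Fin 2} (hw : IsFixedWord w) (n : ℕ) :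
    Nat.count (fun j => w j = 0) (imageLength w n) = n := by
  induction n with
  | zero => simp [imageLength, wordPrefix]
  | succ n ih =>
    obtain ⟨-, h2, h3⟩ := hw.block n
    rw [h2, Nat.count_add, ih, h3]

theorem IsFixedWord.isZeroPositions {w : ℕ → Fin 2} (hw : IsFixedWord w) :
    IsZeroPositions w fun n => (imageLength w n.natPred : ℤ) + 1 := by
  intro n
  refine ⟨_, rfl, (hw.block _).1, ?_⟩
  rw [Nat.count_succ_eq_succ_count (p := fun j => w j = 0) (hw.block _).1,
    hw.count_imageLength, PNat.natPred_add_one]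

theorem IsZeroPositions.unique {w : ℕ → Fin 2} {c c' : ℕ+ → ℤ} (hc : IsZeroPositions w c)
    (hc' : IsZeroPositions w c') : c = c' := by
  funext n
  obtain ⟨i, h1, h2, h3⟩ := hc n
  obtain ⟨j, h4, h5, h6⟩ := hc' n
  rw [Nat.count_succ_eq_succ_count (p := fun j => w j = 0) h2] at h3
  rw [Nat.count_succ_eq_succ_count (p := fun j => w j = 0) h5] at h6
  obtain rfl : i = j := Nat.count_injective (p := fun j => w j = 0) h2 h5 (by omega)
  rw [h1, h4]

theorem IsZeroPositions.eq_zero_iff {w : ℕ → Fin 2} {c : ℕ+ → ℤ} (hc : IsZeroPositions w c)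
    (i : ℕ) : w i = 0 ↔ InSeq i.succPNat c := by
  constructor
  · intro hi
    refine ⟨(Nat.count (fun j => w j = 0) i).succPNat, ?_⟩
    obtain ⟨j, h1, h2, h3⟩ := hc (Nat.count (fun j => w j = 0) i).succPNat
    rw [Nat.count_succ_eq_succ_count (p := fun j => w j = 0) h2, Nat.succPNat_coe] at h3
    obtain rfl : j = i := Nat.count_injective (p := fun j => w j = 0) h2 hi (by omega)
    simp [h1]
  · rintro ⟨m, hm⟩
    obtain ⟨j, h1, h2, -⟩ := hc m
    rw [h1] at hm
    have : j = i := by simpa using hm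
    rwa [← this]

theorem IsFixedWord.isSimpleSeq {w : ℕ → Fin 2} {c : ℕ+ → ℤ} (hw : IsFixedWord w)
    (hc : IsZeroPositions w c) : IsSimpleSeq c := by
  have hS : ∀ n, c (Nat.succPNat n) = imageLength w n + 1 := fun n => by
    rw [hc.unique hw.isZeroPositions]
    simp only [Nat.natPred_succPNat]
  classical
  have hstep : ∀ n : ℕ+, c (n + 1) = c n + (if InSeq n c then 3 else 2) := by
    intro n
    obtain ⟨k, rfl⟩ : ∃ k, n = Nat.succPNat k := ⟨n.natPred, n.succPNat_natPred.symm⟩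
    have h1 : Nat.succPNat k + 1 = Nat.succPNat (k + 1) := rfl
    rw [h1, hS, hS, (hw.block k).2.1]
    simp only [hc.eq_zero_iff]
    push_cast
    ring
  refine ⟨?_, fun n hn => by rw [hstep, if_neg hn], fun n hn => by rw [hstep, if_pos hn]⟩
  have := hS 0
  rwa [show imageLength w 0 = 0 from rfl] at this

open Classical in
/-- The word over `{0, 1}` whose zeros are at the positions given by the terms of `s`; the letter
with index `i` is at position `i + 1`. -/
noncomputable def wordOfSeq (s : ℕ+ → ℤ) (i : ℕ) : Fin 2 := if InSeq i.succPNat s then 0 else 1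

theorem isFixedWord_wordOfSeq {s : ℕ+ → ℤ} (hs : IsSimpleSeq s) : IsFixedWord (wordOfSeq s) := by
  set w := wordOfSeq s with hw
  have key : ∀ n : ℕ, ∃ m : ℕ, s n.succPNat = m + 1 ∧
      (wordPrefix w n).flatMap phi = wordPrefix w m := by
    intro n
    induction n with
    | zero => exact ⟨0, hs.one, rfl⟩
    | succ n ih =>
      obtain ⟨m, h1, h2⟩ := ih
      have h3 : Nat.succPNat (n + 1) = Nat.succPNat n + 1 := rfl
      have hm0 : w m = 0 := if_pos ⟨n.succPNat, by simp [h1]⟩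
      have hne : ∀ j : ℕ, 0 < j → (m + j + 1 : ℤ) < s (n.succPNat + 1) → w (m + j) = 1 := by
        intro j hj hlt
        refine if_neg (not_inSeq_of_between (n := n.succPNat) hs.gap ?_ ?_)
        · rw [h1]; push_cast [Nat.succPNat_coe]; omega
        · push_cast [Nat.succPNat_coe]; omega
      by_cases hn : InSeq n.succPNat s
      · have h4 := hs.step_mem _ hn
        have hwn : w n = 0 := if_pos hn
        have e1 := hne 1 (by omega) (by omega)
        have e2 := hne 2 (by omega) (by omega)
        refine ⟨m + 3, by rw [h3, h4, h1]; push_cast; ring, ?_⟩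
        rw [flatMap_wordPrefix_succ, h2, wordPrefix_add, hwn]
        simp [phi, List.range_succ, hm0, e1, e2]
      · have h4 := hs.step_not_mem _ hn
        have hwn : w n = 1 := if_neg hn
        have e1 := hne 1 (by omega) (by omega)
        refine ⟨m + 2, by rw [h3, h4, h1]; push_cast; ring, ?_⟩
        rw [flatMap_wordPrefix_succ, h2, wordPrefix_add, hwn]
        simp [phi, List.range_succ, hm0, e1]
  intro n
  obtain ⟨m, -, h⟩ := key n
  exact ⟨m, h⟩

theorem IsFixedWord.eq_wordOfSeq {w : ℕ → Fin 2} (hw : IsFixedWord w) {s : ℕ+ → ℤ}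
    (hs : IsSimpleSeq s) : w = wordOfSeq s := by
  have hc := hw.isZeroPositions
  rw [(hw.isSimpleSeq hc).unique hs] at hc
  funext i
  by_cases hi : InSeq i.succPNat s
  · rw [wordOfSeq, if_pos hi, hc.eq_zero_iff]
    exact hi
  · have h0 := mt (hc.eq_zero_iff i).mp hi
    rw [wordOfSeq, if_neg hi]
    omega

theorem isMorphicSeq_iff {s : ℕ+ → ℤ} (hs : IsSimpleSeq s) (c : ℕ+ → ℤ) :
    IsMorphicSeq c ↔ c = s := by
  constructor
  · rintro ⟨w, hw, hc⟩
    exact (hw.isSimpleSeq hc).unique hs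
  · rintro rfl
    have hw := isFixedWord_wordOfSeq hs
    refine ⟨_, hw, ?_⟩
    have hc := hw.isZeroPositions
    rwa [(hw.isSimpleSeq hc).unique hs] at hc

/-! ### The recurrence starting at `4 / π` -/

/-- The integrals `∫ (√2 cos x - 1) ^ m` over `[0, π / 4]`, on which the integrand is
nonnegative. -/
noncomputable def cosIntegral (m : ℕ) : ℝ :=
  ∫ x in (0 : ℝ)..(Real.pi / 4), (Real.sqrt 2 * Real.cos x - 1) ^ m

theorem cosIntegral_zero : cosIntegral 0 = Real.pi / 4 := by
  simp [cosIntegral]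

theorem cosIntegral_pos (m : ℕ) : 0 < cosIntegral m := by
  have hpi := Real.pi_pos
  refine intervalIntegral.intervalIntegral_pos_of_pos_on
    (Continuous.intervalIntegrable (by fun_prop) _ _) (fun x hx => pow_pos ?_ m) (by positivity)
  have h1 : Real.cos (Real.pi / 4) < Real.cos x :=
    Real.cos_lt_cos_of_nonneg_of_le_pi hx.1.le (by linarith) hx.2
  rw [Real.cos_pi_div_four] at h1
  have hs : Real.sqrt 2 * Real.sqrt 2 = 2 := Real.mul_self_sqrt (by norm_num)
  nlinarith [Real.sqrt_pos.mpr (show (0 : ℝ) < 2 by norm_num)]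

theorem sqrt_two_mul_cos_pi_div_four : Real.sqrt 2 * Real.cos (Real.pi / 4) = 1 := by
  have hs : Real.sqrt 2 * Real.sqrt 2 = 2 := Real.mul_self_sqrt (by norm_num)
  rw [Real.cos_pi_div_four]
  linarith

theorem cosIntegral_zero_add_one : cosIntegral 0 + cosIntegral 1 = 1 := by
  have h : cosIntegral 1 = Real.sqrt 2 * Real.sin (Real.pi / 4) - Real.pi / 4 := by
    simp only [cosIntegral, pow_one]
    rw [intervalIntegral.integral_sub (Continuous.intervalIntegrable (by fun_prop) _ _)
      (Continuous.intervalIntegrable (by fun_prop) _ _), intervalIntegral.integral_const_mul,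
      integral_cos]
    simp
  rw [h, cosIntegral_zero, Real.sin_pi_div_four, ← Real.cos_pi_div_four,
    sqrt_two_mul_cos_pi_div_four]
  ring

/-- Integrating the derivative of `√2 sin x (√2 cos x - 1) ^ (m + 1)`, which vanishes at both ends
of the interval. -/
theorem cosIntegral_recurrence (m : ℕ) :
    ((m : ℝ) + 1) * cosIntegral m =
      (2 * m + 3) * cosIntegral (m + 1) + (m + 2) * cosIntegral (m + 2) := by
  have hs : Real.sqrt 2 ^ 2 = 2 := Real.sq_sqrt (by norm_num)
  have hint : ∀ (a : ℝ) (k : ℕ), IntervalIntegrable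
      (fun x => a * (Real.sqrt 2 * Real.cos x - 1) ^ k) MeasureTheory.volume 0 (Real.pi / 4) :=
    fun a k => Continuous.intervalIntegrable (by fun_prop) _ _
  have hder : ∀ x : ℝ, HasDerivAt
      (fun x => Real.sqrt 2 * Real.sin x * (Real.sqrt 2 * Real.cos x - 1) ^ (m + 1))
      (((m : ℝ) + 2) * (Real.sqrt 2 * Real.cos x - 1) ^ (m + 2) +
        (2 * m + 3) * (Real.sqrt 2 * Real.cos x - 1) ^ (m + 1) -
        (m + 1) * (Real.sqrt 2 * Real.cos x - 1) ^ m) x := by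
    intro x
    have h1 := (Real.hasDerivAt_sin x).const_mul (Real.sqrt 2)
    have h2 := (((Real.hasDerivAt_cos x).const_mul (Real.sqrt 2)).sub_const 1).pow (m + 1)
    refine (h1.mul h2).congr_deriv ?_
    have hsin : Real.sqrt 2 ^ 2 * Real.sin x ^ 2 = 2 - (Real.sqrt 2 * Real.cos x) ^ 2 := by
      rw [Real.sin_sq, mul_pow, hs]
      ring
    rw [Pi.pow_apply, Nat.add_sub_cancel]
    push_cast
    linear_combination
      -((m : ℝ) + 1) * (Real.sqrt 2 * Real.cos x - 1) ^ m * hsin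
  have h := intervalIntegral.integral_eq_sub_of_hasDerivAt (a := 0) (b := Real.pi / 4)
    (fun x _ => hder x) (Continuous.intervalIntegrable (by fun_prop) _ _)
  rw [intervalIntegral.integral_sub ((hint _ _).add (hint _ _)) (hint _ _),
    intervalIntegral.integral_add (hint _ _) (hint _ _)] at h
  simp only [intervalIntegral.integral_const_mul] at h
  rw [sqrt_two_mul_cos_pi_div_four] at h
  simp at h
  simp only [cosIntegral]
  linarith

/-- The solution of the recurrence, shifted to start at index `0`: the ratio
`n * cosIntegral (n - 1) / cosIntegral n`, with numerator `1` at `n = 0`. -/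
noncomputable def piTerm : ℕ → ℝ
  | 0 => 1 / cosIntegral 0
  | n + 1 => (n + 1) * cosIntegral n / cosIntegral (n + 1)

theorem piTerm_pos (n : ℕ) : 0 < piTerm n := by
  cases n with
  | zero => exact one_div_pos.mpr (cosIntegral_pos 0)
  | succ n =>
    have h1 := cosIntegral_pos n
    have h2 := cosIntegral_pos (n + 1)
    rw [piTerm]
    positivity

theorem piTerm_sub (n : ℕ) :
    piTerm n - (2 * n + 1) = (n + 1) * cosIntegral (n + 1) / cosIntegral n := by
  cases n with
  | zero =>
    have h1 := (cosIntegral_pos 0).ne'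
    have := cosIntegral_zero_add_one
    rw [piTerm]
    field_simp
    push_cast
    linarith
  | succ n =>
    have h1 := (cosIntegral_pos (n + 1)).ne'
    have := cosIntegral_recurrence n
    rw [piTerm]
    field_simp
    push_cast
    linarith

theorem piTerm_sub_pos (n : ℕ) : 0 < piTerm n - (2 * n + 1) := by
  have h1 := cosIntegral_pos n
  have h2 := cosIntegral_pos (n + 1)
  rw [piTerm_sub]
  positivity

theorem piTerm_succ (n : ℕ) :
    piTerm (n + 1) = ((n : ℝ) + 1) ^ 2 / (piTerm n - (2 * n + 1)) := by
  have h1 := (cosIntegral_pos n).ne'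
  have h2 := (cosIntegral_pos (n + 1)).ne'
  rw [piTerm_sub, piTerm]
  field_simp

theorem isPiRecurrence_piTerm : IsPiRecurrence fun n => piTerm n.natPred := by
  have hcast : ∀ n : ℕ+, 2 * (n : ℝ) - 1 = 2 * n.natPred + 1 := fun n => by
    have : ((n.natPred + 1 : ℕ) : ℝ) = n := by rw [PNat.natPred_add_one]
    push_cast at this
    linarith
  refine ⟨?_, fun n => ?_, fun n => ?_⟩
  · change piTerm 0 = _
    rw [piTerm, cosIntegral_zero, one_div_div]
  · rw [hcast]
    exact (piTerm_sub_pos _).ne'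
  · have h1 : (n + 1).natPred = n.natPred + 1 := (PNat.natPred_add_one n).symm
    have h2 : (n : ℝ) = n.natPred + 1 := by have := hcast n; linarith
    simp only [h1, hcast]
    rw [piTerm_succ, h2]

theorem IsPiRecurrence.unique {r r' : ℕ+ → ℝ} (h : IsPiRecurrence r) (h' : IsPiRecurrence r') :
    r = r' := by
  funext n
  induction n using PNat.recOn with
  | one => rw [h.one, h'.one]
  | succ n ih => rw [h.step, h'.step, ih]

/-! ### Bounds for positive solutions of the recurrence -/

theorem four_mul_le_of_sq_div_sub {N a b c : ℝ} (hN : 0 < N) (ha : 2 * N ≤ a) (hb : 2 * N ≤ b)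
    (hc : 0 < c) (h : c ≤ N ^ 2 / a - N ^ 2 / b) : 4 * c ≤ b - a := by
  have ha0 : 0 < a := by linarith
  have hb0 : 0 < b := by linarith
  have hab : 4 * N ^ 2 ≤ a * b := by nlinarith
  have h1 : c * (a * b) ≤ N ^ 2 * (b - a) := by
    have : N ^ 2 / a - N ^ 2 / b = N ^ 2 * (b - a) / (a * b) := by field_simp
    rwa [this, le_div_iff₀ (by positivity)] at h
  have h2 : N ^ 2 * (4 * c) ≤ N ^ 2 * (b - a) := by nlinarith
  exact le_of_mul_le_mul_left h2 (by positivity)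

/-- A backward iteration `r n = 2 n + 1 + (n + 1) ^ 2 / r (n + 1)` is antitone and contracts
distances by a factor of at least four. If it maps each interval `[l (n + 1), u (n + 1)]` into
`[l n, u n]`, then a positive solution that left one of the intervals would move away from the later
ones exponentially fast, although it grows at most linearly. -/
theorem mem_Icc_of_backward_iteration {r l u : ℕ → ℝ} (hr : ∀ n, 0 < r n)
    (hrec : ∀ n : ℕ, r n = 2 * n + 1 + ((n : ℝ) + 1) ^ 2 / r (n + 1))
    (hl : ∀ n : ℕ, 2 * (n : ℝ) ≤ l n) (hl' : ∀ n : ℕ, l n ≤ 3 * (n + 1)) (hlu : ∀ n, l n ≤ u n)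
    (hFu : ∀ n : ℕ, 2 * n + 1 + ((n : ℝ) + 1) ^ 2 / l (n + 1) ≤ u n)
    (hFl : ∀ n : ℕ, l n ≤ 2 * n + 1 + ((n : ℝ) + 1) ^ 2 / u (n + 1)) (n : ℕ) :
    r n ∈ Set.Icc (l n) (u n) := by
  have hr2 : ∀ n : ℕ, 2 * (n : ℝ) + 1 ≤ r n := fun n => by
    have := hr (n + 1)
    have : 0 ≤ ((n : ℝ) + 1) ^ 2 / r (n + 1) := by positivity
    linarith [hrec n]
  have hr3 : ∀ n : ℕ, r n ≤ 3 * (n + 1) := fun n => by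
    have h1 := hr2 (n + 1)
    push_cast at h1
    have : ((n : ℝ) + 1) ^ 2 / r (n + 1) ≤ n + 1 := by
      rw [div_le_iff₀ (hr _)]
      nlinarith
    linarith [hrec n]
  -- Growth of the distance to the interval.
  have hgrow : ∀ n : ℕ, ∀ c : ℝ, 0 < c → c ≤ max (r n - u n) (l n - r n) →
      4 * c ≤ max (r (n + 1) - u (n + 1)) (l (n + 1) - r (n + 1)) := by
    intro n c hc h
    have hN : (0 : ℝ) < n + 1 := by positivity
    have h1 := hl (n + 1)
    have h2 := hr2 (n + 1)
    have h3 := hlu (n + 1)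
    push_cast at h1 h2
    rcases le_max_iff.mp h with h | h
    · exact le_max_of_le_right (four_mul_le_of_sq_div_sub hN (by linarith) (by linarith) hc
        (by linarith [hrec n, hFu n]))
    · exact le_max_of_le_left (four_mul_le_of_sq_div_sub hN (by linarith) (by linarith) hc
        (by linarith [hrec n, hFl n]))
  by_contra hn
  obtain ⟨c, hc, hcn⟩ : ∃ c > 0, c ≤ max (r n - u n) (l n - r n) := by
    refine ⟨_, ?_, le_rfl⟩
    rw [Set.mem_Icc, not_and_or, not_le, not_le] at hn
    rcases hn with hn | hn
    · exact lt_max_of_lt_right (by linarith)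
    · exact lt_max_of_lt_left (by linarith)
  have hpow : ∀ k : ℕ, 4 ^ k * c ≤ 3 * ((n : ℝ) + k + 1) := by
    intro k
    have h : 4 ^ k * c ≤ max (r (n + k) - u (n + k)) (l (n + k) - r (n + k)) := by
      induction k with
      | zero => simpa using hcn
      | succ k ih =>
        have := hgrow (n + k) (4 ^ k * c) (by positivity) ih
        rw [pow_succ, mul_comm (4 ^ k : ℝ) 4, mul_assoc]
        exact this
    have h1 := hr (n + k)
    have h2 := hr3 (n + k)
    have h3 := hl (n + k)
    have h4 := hl' (n + k)
    have h5 := hlu (n + k)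
    push_cast at h2 h3 h4
    have h6 : (0 : ℝ) ≤ n + k := by positivity
    exact h.trans (max_le (by linarith) (by linarith))
  obtain ⟨k, hk⟩ := pow_unbounded_of_one_lt (3 * ((n : ℝ) + 1) / c) (by norm_num : (1 : ℝ) < 2)
  rw [div_lt_iff₀ hc] at hk
  have h1 : (k : ℝ) + 1 ≤ 2 ^ k := by exact_mod_cast Nat.lt_two_pow_self (n := k)
  have h2 : (4 : ℝ) ^ k = 2 ^ k * 2 ^ k := by rw [← mul_pow]; norm_num
  have h3 := hpow k
  rw [h2] at h3
  have h4 : (0 : ℝ) ≤ (n : ℝ) * k := by positivity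
  nlinarith

/-- The interval comes from the asymptotic expansion of `r n` at infinity: its lower end is the
linear part, and its upper end the image of the next lower end under the backward iteration. -/
theorem piTerm_mem_Icc (n : ℕ) :
    piTerm n ∈ Set.Icc ((1 + Real.sqrt 2) * ((n : ℝ) + 1 / 2))
      ((1 + Real.sqrt 2) * ((n : ℝ) + 1 / 2) + (Real.sqrt 2 - 1) / (4 * (n + 3 / 2))) := by
  have hs : Real.sqrt 2 ^ 2 = 2 := Real.sq_sqrt (by norm_num)
  have hs1 : 1.4 < Real.sqrt 2 := Real.lt_sqrt_of_sq_lt (by norm_num)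
  have hs2 : Real.sqrt 2 < 1.5 := (Real.sqrt_lt' (by norm_num)).mpr (by norm_num)
  set σ := Real.sqrt 2 with hσ
  have hδ : ∀ n : ℕ, 0 ≤ (σ - 1) / (4 * ((n : ℝ) + 3 / 2)) := fun n =>
    div_nonneg (by linarith) (by positivity)
  have hFl : ∀ n : ℕ, 2 * (n : ℝ) + 1 + ((n : ℝ) + 1) ^ 2 / ((1 + σ) * ((n : ℝ) + 1 + 1 / 2)) =
      (1 + σ) * ((n : ℝ) + 1 / 2) + (σ - 1) / (4 * (n + 3 / 2)) := fun n => by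
    have h1 : (0 : ℝ) < 1 + σ := by linarith
    have h2 : (0 : ℝ) < (n : ℝ) + 3 / 2 := by positivity
    have h3 : ((n : ℝ) + 1) ^ 2 / ((1 + σ) * ((n : ℝ) + 1 + 1 / 2)) =
        (σ - 1) * (n + 1) ^ 2 / (n + 3 / 2) := by
      rw [div_eq_div_iff (by positivity) (by positivity)]
      linear_combination (-((n : ℝ) + 1) ^ 2 * (n + 3 / 2)) * hs
    rw [h3]
    field_simp
    ring
  refine mem_Icc_of_backward_iteration
    (l := fun n : ℕ => (1 + σ) * ((n : ℝ) + 1 / 2))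
    (u := fun n : ℕ => (1 + σ) * ((n : ℝ) + 1 / 2) + (σ - 1) / (4 * (n + 3 / 2)))
    piTerm_pos ?_ ?_ ?_ ?_ ?_ ?_ n
  · intro n
    have h1 := piTerm_sub_pos n
    rw [piTerm_succ]
    field_simp
    ring
  · intro n
    have : (0 : ℝ) ≤ n := by positivity
    nlinarith
  · intro n
    have : (0 : ℝ) ≤ n := by positivity
    nlinarith
  · intro n
    have := hδ n
    linarith
  · intro n
    push_cast
    exact (hFl n).le
  · intro n
    have hn : (0 : ℝ) ≤ n := by positivity
    push_cast
    set ε := (σ - 1) / (4 * ((n : ℝ) + 1 + 3 / 2)) with hε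
    have hε0 : 0 ≤ ε := by have := hδ (n + 1); push_cast at this; exact this
    have hε1 : ε * (4 * ((n : ℝ) + 1 + 3 / 2)) = σ - 1 := div_mul_cancel₀ _ (by positivity)
    have hden : 0 < (1 + σ) * ((n : ℝ) + 1 + 1 / 2) + ε := by positivity
    suffices (σ - 1) * (n + 1 / 2) ≤ (n + 1) ^ 2 / ((1 + σ) * ((n : ℝ) + 1 + 1 / 2) + ε) by
      linarith
    rw [le_div_iff₀ hden]
    have h1 : (n + 1 / 2) * ε ≤ 1 / 8 := by nlinarith
    have h2 : (σ - 1) * ((n + 1 / 2) * ε) ≤ 1 / 2 * (1 / 8) :=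
      mul_le_mul (by linarith) h1 (by positivity) (by norm_num)
    have h3 : (σ - 1) * (n + 1 / 2) * ((1 + σ) * ((n : ℝ) + 1 + 1 / 2)) =
        (n + 1 / 2) * (n + 3 / 2) := by
      linear_combination ((n : ℝ) + 1 / 2) * (n + 3 / 2) * hs
    nlinarith

/-- Rounding is not affected by the deviation of `piTerm n` from `(1 + √2) (n + 1 / 2)`: for an
integer `j > (n + 1 / 2) √2`, the integer `2 j ^ 2` exceeds `(2 n + 1) ^ 2` by at least one, so that
`j` is farther away from `(n + 1 / 2) √2` than this deviation. -/
theorem floor_piTerm (n : ℕ) :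
    ⌊piTerm n + 1 / 2⌋ = ⌊(1 + Real.sqrt 2) * ((n : ℝ) + 1) - 1 / 2 * Real.sqrt 2⌋ := by
  obtain ⟨h1, h2⟩ := piTerm_mem_Icc n
  have hs : Real.sqrt 2 ^ 2 = 2 := Real.sq_sqrt (by norm_num)
  have hs1 : 1.4 < Real.sqrt 2 := Real.lt_sqrt_of_sq_lt (by norm_num)
  have hs2 : Real.sqrt 2 < 1.42 := (Real.sqrt_lt' (by norm_num)).mpr (by norm_num)
  set σ := Real.sqrt 2 with hσ
  have hn : (0 : ℝ) ≤ n := by positivity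
  set δ := (σ - 1) / (4 * ((n : ℝ) + 3 / 2)) with hδ
  have hδ0 : 0 ≤ δ := div_nonneg (by linarith) (by positivity)
  have hδ1 : δ * (4 * ((n : ℝ) + 3 / 2)) = σ - 1 := div_mul_cancel₀ _ (by positivity)
  have hk1 := Int.floor_le ((1 + σ) * ((n : ℝ) + 1) - 1 / 2 * σ)
  have hk2 := Int.lt_floor_add_one ((1 + σ) * ((n : ℝ) + 1) - 1 / 2 * σ)
  generalize ⌊(1 + σ) * ((n : ℝ) + 1) - 1 / 2 * σ⌋ = k at hk1 hk2 ⊢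
  rw [Int.floor_eq_iff]
  refine ⟨by linarith, ?_⟩
  by_contra! hk3
  obtain ⟨j, hj⟩ : ∃ j : ℤ, j = k - n := ⟨_, rfl⟩
  have hjR : (j : ℝ) = k - n := by rw [hj]; push_cast; ring
  have hj1 : σ * (n + 1 / 2) < j := by rw [hjR]; linarith
  have hj2 : (j : ℝ) ≤ σ * (n + 1 / 2) + δ := by rw [hjR]; linarith
  have hx : 0 ≤ σ * ((n : ℝ) + 1 / 2) := by positivity
  have hsq : (σ * ((n : ℝ) + 1 / 2)) ^ 2 = 2 * (n + 1 / 2) ^ 2 := by rw [mul_pow, hs]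
  have hint : (2 * (n : ℤ) + 1) ^ 2 + 1 ≤ 2 * j ^ 2 := by
    have : (2 * (n : ℝ) + 1) ^ 2 < 2 * j ^ 2 := by nlinarith
    have : (2 * (n : ℤ) + 1) ^ 2 < 2 * j ^ 2 := by exact_mod_cast this
    omega
  have hint' : (2 * (n : ℝ) + 1) ^ 2 + 1 ≤ 2 * (j : ℝ) ^ 2 := by exact_mod_cast hint
  have hjsq : (j : ℝ) ^ 2 ≤ (σ * (n + 1 / 2) + δ) ^ 2 :=
    pow_le_pow_left₀ (hx.trans hj1.le) hj2 2
  have hδ2 : δ ≤ 0.1 := by nlinarith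
  have hδn : δ * (n + 1 / 2) ≤ 0.105 := by nlinarith
  have hδσ : σ * (δ * (n + 1 / 2)) ≤ 1.42 * 0.105 :=
    mul_le_mul hs2.le hδn (by positivity) (by norm_num)
  nlinarith

theorem isRoundingSeq_iff_isBeattySeq (e : ℕ+ → ℤ) : IsRoundingSeq e ↔ IsBeattySeq e := by
  have hfloor : ∀ n : ℕ+, ⌊piTerm n.natPred + 1 / 2⌋ =
      ⌊(1 + Real.sqrt 2) * (n : ℝ) - 1 / 2 * Real.sqrt 2⌋ := fun n => by
    have : ((n.natPred + 1 : ℕ) : ℝ) = n := by rw [PNat.natPred_add_one]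
    push_cast at this
    rw [floor_piTerm, this]
  constructor
  · rintro ⟨r, hr, he⟩ n
    rw [he, hr.unique isPiRecurrence_piTerm, hfloor]
  · intro he
    exact ⟨_, isPiRecurrence_piTerm, fun n => by rw [he, hfloor]⟩

/-! ### Agreement of the five descriptions -/

theorem theorem1 :
    (∃! w : ℕ → Fin 2, IsFixedWord w) ∧
    (∃! r : ℕ+ → ℝ, IsPiRecurrence r) ∧
    ∃ s : ℕ+ → ℤ,
      (∀ a : ℕ+ → ℤ, IsCloitreSeq a ↔ a = s) ∧
      (∀ b : ℕ+ → ℤ, IsSimpleSeq b ↔ b = s) ∧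
      (∀ c : ℕ+ → ℤ, IsMorphicSeq c ↔ c = s) ∧
      (∀ d : ℕ+ → ℤ, IsBeattySeq d ↔ d = s) ∧
      (∀ e : ℕ+ → ℤ, IsRoundingSeq e ↔ e = s) := by
  obtain ⟨s, hB⟩ : ∃ s, IsBeattySeq s := ⟨_, fun _ => rfl⟩
  have hs := isSimpleSeq_of_isBeattySeq hB
  have hb : ∀ b : ℕ+ → ℤ, IsSimpleSeq b ↔ b = s := fun b =>
    ⟨fun h => h.unique hs, fun h => h ▸ hs⟩
  have hd : ∀ d : ℕ+ → ℤ, IsBeattySeq d ↔ d = s := fun d =>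
    ⟨fun h => funext fun n => (h n).trans (hB n).symm, fun h => h ▸ hB⟩
  refine ⟨⟨_, isFixedWord_wordOfSeq hs, fun w hw => hw.eq_wordOfSeq hs⟩,
    ⟨_, isPiRecurrence_piTerm, fun r hr => hr.unique isPiRecurrence_piTerm⟩, s,
    fun a => isCloitreSeq_iff_isSimpleSeq.trans (hb a), hb, isMorphicSeq_iff hs, hd,
    fun e => (isRoundingSeq_iff_isBeattySeq e).trans (hd e)⟩
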